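/- Let $(X,d)$ be a metric space and let $\mathcal{B}$ be a bornology on $X$, that is, a family of nonempty subsets of $X$ that covers $X$ and is closed under finite unions and under passing to nonempty subsets. A base of $\mathcal{B}$ is a subfamily $\mathcal{B}_0\subseteq\mathcal{B}$ such that every member of $\mathcal{B}$ is contained in a member of $\mathcal{B}_0$; assume that $\mathcal{B}$ has a base consisting of closed sets. Put $$w_X(\mathcal{B})=\aleph_0+\min\{|\mathcal{B}_0| : \mathcal{B}_0 \text{ is a base of } \mathcal{B}\}.$$ Let $C(X)$ be the additive group of continuous functions $X\to\mathbb{R}$, and let $\tau_{\mathcal{B}}^{w}$ be the topology on $C(X)$ (of Whitney convergence on $\mathcal{B}$) given by the uniformity generated by the entourages $$[B,\epsilon]^w=\{(f,g) : |f(x)-g(x)|<\epsilon(x)\text{ for all }x\in B\},\qquad B\in\mathcal{B},\ \epsilon\in C(X),\ \epsilon>0 .$$ Then $$w(C(X),\tau_{\mathcal{B}}^{w})=w_X(\mathcal{B})\cdot ib(C(X),\tau_{\mathcal{B}}^{w})=w_X(\mathcal{B})\cdot c(C(X),\tau_{\mathcal{B}}^{w})=w_X(\mathcal{B})\cdot L(C(X),\tau_{\mathcal{B}}^{w})=w_X(\mathcal{B})\cdot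 d(C(X),\tau_{\mathcal{B}}^{w})=w_X(\mathcal{B})\cdot nw(C(X),\tau_{\mathcal{B}}^{w}).$$ In particular, for the Whitney topology $\tau^w$ on $C(X)$, which is $\tau^w_{\mathcal{B}}$ for the family $\mathcal{B}$ of all nonempty subsets of $X$, $$w(C(X),\tau^{w})=ib(C(X),\tau^{w})=c(C(X),\tau^{w})=L(C(X),\tau^{w})=d(C(X),\tau^{w})=nw(C(X),\tau^{w}).$$ Here, for a topological space $Y$, each of the following is $\aleph_0$ plus the indicated cardinal: the weight $w(Y)$, the least cardinality of a base of open sets; the density $d(Y)$, the least cardinality of a dense subset; the Lindelöf degree $L(Y)$, the least $\kappa$ such that every open cover has a subcover of cardinality at most $\kappa$; the cellularity $c(Y)$, the supremum of the cardinalities of families of pairwise disjoint open sets; the network weight $nw(Y)$, the least cardinality of a network, i.e. of a family $\mathcal{N}$ of nonempty subsets of $Y$ such that for every open $U$ and $y\in U$ there is $N\in\mathcal{N}$ with $y\in N\subseteq U$; and, if $Y$ is a topological group written additively, the index of narrowness $ib(Y)$, the least infinite $\kappa$ such that for every neighbourhood $U$ of $0$ there is $S\subseteq Y$ with $|S|\le\kappa$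 and $U+S=Y$. -/

import Mathlib

open Set Filter
open scoped Cardinal Pointwise

universe u

namespace WhitneyBornology

/-! ### Bornologies -/

section Bornologies

variable {X : Type u}

/-- A bornology on a set `X`: a family of nonempty subsets of `X` that is an ideal (closed under
finite unions and under passing to nonempty subsets) and covers `X`. -/
structure IsBornology (𝓑 : Set (Set X)) : Prop where
  nonempty : ∀ B ∈ 𝓑, B.Nonempty
  subset : ∀ B ∈ 𝓑, ∀ A ⊆ B, A.Nonempty → A ∈ 𝓑
  union : ∀ A ∈ 𝓑, ∀ B ∈ 𝓑, A ∪ B ∈ 𝓑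
  cover : ⋃₀ 𝓑 = univ

/-- `𝓑₀` is a base of `𝓑`: a subfamily such that each member of `𝓑` lies in a member of `𝓑₀`. -/
def IsBase (𝓑 𝓑₀ : Set (Set X)) : Prop :=
  𝓑₀ ⊆ 𝓑 ∧ ∀ B ∈ 𝓑, ∃ B' ∈ 𝓑₀, B ⊆ B'

/-- `𝓑` has a base consisting of closed sets. -/
def HasClosedBase [TopologicalSpace X] (𝓑 : Set (Set X)) : Prop :=
  ∃ 𝓑₀, IsBase 𝓑 𝓑₀ ∧ ∀ B ∈ 𝓑₀, IsClosed B

/-- The weight `w_X(𝓑)`: `ℵ₀` plus the least cardinality of a base of `𝓑`. -/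
noncomputable def bornologyWeight (𝓑 : Set (Set X)) : Cardinal.{u} :=
  ℵ₀ + sInf {κ | ∃ 𝓑₀, IsBase 𝓑 𝓑₀ ∧ #𝓑₀ = κ}

/-- The largest bornology `𝓟₀(X)`: all nonempty subsets of `X`. -/
def nonemptySets (X : Type u) : Set (Set X) := {A | A.Nonempty}

theorem isBornology_nonemptySets : IsBornology (nonemptySets X) where
  nonempty _ h := h
  subset _ _ _ _ h := h
  union _ hA _ _ := hA.inl
  cover := sUnion_eq_univ_iff.2 fun x => ⟨{x}, singleton_nonempty x, rfl⟩

end Bornologies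

/-! ### The topology of Whitney convergence on a bornology -/

section Topology

variable {X : Type u} [TopologicalSpace X]

/-- The set `C⁺(X)` of positive continuous real functions on `X`. -/
def positiveFunctions (X : Type u) [TopologicalSpace X] : Set C(X, ℝ) := {ε | ∀ x, 0 < ε x}

/-- The set `[B, ε]^w` of all pairs `(f, g)` such that `|f x - g x| < ε x` for all `x ∈ B`. -/
def entourage (B : Set X) (ε : C(X, ℝ)) : Set (C(X, ℝ) × C(X, ℝ)) :=
  {p | ∀ x ∈ B, |p.1 x - p.2 x| < ε x}

/-- The filter generated by the sets `[B, ε]^w` with `B ∈ 𝓑` and `ε ∈ C⁺(X)`. -/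
def entourageFilter (𝓑 : Set (Set X)) : Filter (C(X, ℝ) × C(X, ℝ)) :=
  ⨅ B ∈ 𝓑, ⨅ ε ∈ positiveFunctions X, 𝓟 (entourage B ε)

theorem entourage_mem {𝓑 : Set (Set X)} {B : Set X} (hB : B ∈ 𝓑) {ε : C(X, ℝ)}
    (hε : ε ∈ positiveFunctions X) : entourage B ε ∈ entourageFilter 𝓑 :=
  mem_iInf_of_mem B <| mem_iInf_of_mem hB <| mem_iInf_of_mem ε <| mem_iInf_of_mem hε <|
    mem_principal_self _

theorem le_entourageFilter {𝓑 : Set (Set X)} {F : Filter (C(X, ℝ) × C(X, ℝ))}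
    (h : ∀ B ∈ 𝓑, ∀ ε ∈ positiveFunctions X, entourage B ε ∈ F) : F ≤ entourageFilter 𝓑 :=
  le_iInf₂ fun B hB => le_iInf₂ fun ε hε => le_principal_iff.2 (h B hB ε hε)

/-- The uniformity on `C(X)` of Whitney convergence on `𝓑`. -/
@[reducible] def whitneyUniformity (𝓑 : Set (Set X)) : UniformSpace C(X, ℝ) :=
  UniformSpace.ofCore
    { uniformity := entourageFilter 𝓑
      refl := le_entourageFilter fun B _ ε hε => by
        rintro ⟨f, g⟩ h x _
        have hfg : f = g := h
        simpa [hfg] using hε x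
      symm := le_entourageFilter fun B hB ε hε => by
        refine mem_map.2 (mem_of_superset (entourage_mem hB hε) ?_)
        rintro ⟨f, g⟩ h x hx
        simpa [abs_sub_comm] using h x hx
      comp := le_entourageFilter fun B hB ε hε => by
        have hε' : (2⁻¹ : ℝ) • ε ∈ positiveFunctions X := fun x => by
          simpa using hε x
        refine mem_of_superset (mem_lift' (entourage_mem hB hε')) ?_
        rintro ⟨f, g⟩ ⟨k, h₁, h₂⟩ x hx
        have e₁ := h₁ x hx
        have e₂ := h₂ x hx
        simp only [ContinuousMap.smul_apply, smul_eq_mul] at e₁ e₂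
        have e₃ := abs_sub_le (f x) (k x) (g x)
        change |f x - g x| < ε x
        linarith }

/-- If `𝓑` is a bornology on a nonempty space, the sets `[B, ε]^w` form a base of the uniformity. -/
theorem hasBasis_whitneyUniformity [Nonempty X] {𝓑 : Set (Set X)} (h𝓑 : IsBornology 𝓑) :
    (@uniformity _ (whitneyUniformity 𝓑)).HasBasis
      (fun p : Set X × C(X, ℝ) => p.1 ∈ 𝓑 ∧ p.2 ∈ positiveFunctions X)
      (fun p => entourage p.1 p.2) := by
  have hne : 𝓑.Nonempty := by
    obtain ⟨x⟩ := ‹Nonempty X›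
    obtain ⟨B, hB, -⟩ := sUnion_eq_univ_iff.1 h𝓑.cover x
    exact ⟨B, hB⟩
  have hF : entourageFilter 𝓑 =
      ⨅ p ∈ {p : Set X × C(X, ℝ) | p.1 ∈ 𝓑 ∧ p.2 ∈ positiveFunctions X},
        𝓟 (entourage p.1 p.2) := by
    refine le_antisymm (le_iInf₂ fun p hp => le_principal_iff.2 (entourage_mem hp.1 hp.2)) ?_
    exact le_entourageFilter fun B hB ε hε =>
      mem_iInf_of_mem (B, ε) (mem_iInf_of_mem ⟨hB, hε⟩ (mem_principal_self _))
  change (entourageFilter 𝓑).HasBasis _ _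
  rw [hF]
  refine hasBasis_biInf_principal ?_ ?_
  · rintro ⟨B₁, ε₁⟩ ⟨hB₁, hε₁⟩ ⟨B₂, ε₂⟩ ⟨hB₂, hε₂⟩
    refine ⟨(B₁ ∪ B₂, ε₁ ⊓ ε₂), ⟨h𝓑.union _ hB₁ _ hB₂, fun x => ?_⟩, ?_, ?_⟩
    · simpa using ⟨hε₁ x, hε₂ x⟩
    · intro p hp x hx
      exact (lt_inf_iff.1 (hp x (Or.inl hx))).1
    · intro p hp x hx
      exact (lt_inf_iff.1 (hp x (Or.inr hx))).2
  · obtain ⟨B, hB⟩ := hne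
    exact ⟨(B, 1), hB, fun x => by simp⟩

/-- The topology `τ_𝓑^w` on `C(X)` of Whitney convergence on `𝓑`. -/
@[reducible] def whitneyTopologyOn (𝓑 : Set (Set X)) : TopologicalSpace C(X, ℝ) :=
  (whitneyUniformity 𝓑).toTopologicalSpace

/-- The Whitney topology `τ^w` on `C(X)`. -/
@[reducible] def whitneyTopology (X : Type u) [TopologicalSpace X] : TopologicalSpace C(X, ℝ) :=
  whitneyTopologyOn (nonemptySets X)

end Topology

/-! ### Cardinal invariants of a topological space `(Y, t)` -/

section CardinalInvariants

variable {Y : Type u}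

/-- The weight `w(Y)`. -/
noncomputable def weight (t : TopologicalSpace Y) : Cardinal.{u} :=
  ℵ₀ + sInf {κ | ∃ 𝒮 : Set (Set Y), @TopologicalSpace.IsTopologicalBasis Y t 𝒮 ∧ #𝒮 = κ}

/-- The density `d(Y)`. -/
noncomputable def density (t : TopologicalSpace Y) : Cardinal.{u} :=
  ℵ₀ + sInf {κ | ∃ D : Set Y, @Dense Y t D ∧ #D = κ}

/-- The Lindelöf degree `L(Y)`. -/
noncomputable def lindelofDegree (t : TopologicalSpace Y) : Cardinal.{u} :=
  ℵ₀ + sInf {κ | ∀ 𝒰 : Set (Set Y), (∀ U ∈ 𝒰, @IsOpen Y t U) → ⋃₀ 𝒰 = univ →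
    ∃ 𝒱 ⊆ 𝒰, ⋃₀ 𝒱 = univ ∧ #𝒱 ≤ κ}

/-- The cellularity `c(Y)`. -/
noncomputable def cellularity (t : TopologicalSpace Y) : Cardinal.{u} :=
  ℵ₀ + sSup {κ | ∃ 𝒰 : Set (Set Y), (∀ U ∈ 𝒰, @IsOpen Y t U) ∧ 𝒰.PairwiseDisjoint id ∧ #𝒰 = κ}

/-- A network on `Y`: a family of nonempty sets such that for each open `U` and each `y ∈ U` some
member `C` of the family satisfies `y ∈ C ⊆ U`. -/
def IsNetwork (t : TopologicalSpace Y) (𝒩 : Set (Set Y)) : Prop :=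
  (∀ C ∈ 𝒩, C.Nonempty) ∧ ∀ (y : Y) (U : Set Y), @IsOpen Y t U → y ∈ U → ∃ C ∈ 𝒩, y ∈ C ∧ C ⊆ U

/-- The network weight `nw(Y)`. -/
noncomputable def networkWeight (t : TopologicalSpace Y) : Cardinal.{u} :=
  ℵ₀ + sInf {κ | ∃ 𝒩 : Set (Set Y), IsNetwork t 𝒩 ∧ #𝒩 = κ}

/-- `Y` is `κ`-narrow: every neighbourhood `U` of `0` satisfies `U + S = Y` for some `S ⊆ Y` of
cardinality at most `κ`. -/
def IsNarrow [AddGroup Y] (t : TopologicalSpace Y) (κ : Cardinal.{u}) : Prop :=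
  ∀ U ∈ @nhds Y t 0, ∃ S : Set Y, #S ≤ κ ∧ U + S = univ

/-- The index of narrowness `ib(Y)`. -/
noncomputable def narrownessIndex [AddGroup Y] (t : TopologicalSpace Y) : Cardinal.{u} :=
  ℵ₀ + sInf {κ | ℵ₀ ≤ κ ∧ IsNarrow t κ}

end CardinalInvariants

end WhitneyBornology

namespace WhitneyBornology

/-! ### Cardinal arithmetic -/

section Cardinals

/-! In every topological group `ib ≤ c ≤ d ≤ nw ≤ w` and `ib ≤ L ≤ nw`, so all the equalities follow
by sandwiching once `w_X(𝓑) ≤ w ≤ w_X(𝓑) · ib` is known (`eq_mul_of_le`).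

The lower bound `bornologyWeight_le_weight` recovers a base of `𝓑` from the neighbourhoods of `0`:
functions separating points from closed sets detect the set on which a neighbourhood imposes its
condition.

The upper bound `weight_whitney_le` rests on the fact that weight is controlled by narrowness and
character (`weight_le_of_isNarrow`), and that narrowness here also bounds the character. For `B` in
a base of `𝓑`, choose at most `ib` functions `s` whose translates of `[B, 1]` cover `C(X)`. Given `ε
> 0`, some `s` is within `1` of `1/ε` on `B`, so `1/(|s| + 1) < ε` there. The functions `1/(|s| +
1)` thus replace all `ε`. -/

theorem aleph0_add_sInf_le {S : Set Cardinal.{u}} {κ a : Cardinal.{u}} (hκ : ℵ₀ ≤ κ) (ha : a ∈ S)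
    (h : a ≤ κ) : ℵ₀ + sInf S ≤ κ :=
  Cardinal.add_le_of_le hκ hκ ((csInf_le' ha).trans h)

theorem exists_mem_le_aleph0_add_sInf {S : Set Cardinal.{u}} (hS : S.Nonempty) :
    ∃ a ∈ S, a ≤ ℵ₀ + sInf S :=
  ⟨sInf S, csInf_mem hS, self_le_add_left _ _⟩

theorem eq_mul_of_le {w b i φ : Cardinal.{u}} (hw : ℵ₀ ≤ w) (hb : b ≤ w) (hi : w ≤ b * i)
    (h₁ : i ≤ φ) (h₂ : φ ≤ w) : w = b * φ :=
  le_antisymm (hi.trans (mul_le_mul_right h₁ b))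
    ((mul_le_mul' hb h₂).trans_eq (Cardinal.mul_eq_self hw))

end Cardinals

/-! ### Inequalities between cardinal invariants -/

section Spaces

variable {Y : Type u} [t : TopologicalSpace Y]

theorem exists_isTopologicalBasis_le_weight :
    ∃ 𝒮 : Set (Set Y), TopologicalSpace.IsTopologicalBasis 𝒮 ∧ #𝒮 ≤ weight t := by
  obtain ⟨_, ⟨𝒮, h, rfl⟩, hle⟩ := exists_mem_le_aleph0_add_sInf
    (S := {κ | ∃ 𝒮 : Set (Set Y), TopologicalSpace.IsTopologicalBasis 𝒮 ∧ #𝒮 = κ})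
    ⟨_, _, TopologicalSpace.isTopologicalBasis_opens, rfl⟩
  exact ⟨𝒮, h, hle⟩

theorem networkWeight_le_weight : networkWeight t ≤ weight t := by
  obtain ⟨𝒮, h𝒮, hle⟩ := exists_isTopologicalBasis_le_weight (Y := Y)
  refine aleph0_add_sInf_le (self_le_add_right _ _)
    ⟨𝒮 \ {∅}, ⟨fun C hC => nonempty_iff_ne_empty.2 hC.2, fun y U hU hy => ?_⟩, rfl⟩
    ((Cardinal.mk_le_mk_of_subset sdiff_subset).trans hle)
  obtain ⟨C, hC, hyC, hCU⟩ := h𝒮.exists_subset_of_mem_open hy hU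
  exact ⟨C, ⟨hC, Set.Nonempty.ne_empty ⟨y, hyC⟩⟩, hyC, hCU⟩

theorem exists_isNetwork_le_networkWeight :
    ∃ 𝒩 : Set (Set Y), IsNetwork t 𝒩 ∧ #𝒩 ≤ networkWeight t := by
  obtain ⟨_, ⟨𝒩, h, rfl⟩, hle⟩ := exists_mem_le_aleph0_add_sInf
    (S := {κ | ∃ 𝒩 : Set (Set Y), IsNetwork t 𝒩 ∧ #𝒩 = κ})
    ⟨_, {C | C.Nonempty}, ⟨fun _ h => h, fun y U _ hy => ⟨U, ⟨y, hy⟩, hy, Subset.rfl⟩⟩, rfl⟩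
  exact ⟨𝒩, h, hle⟩

theorem density_le_networkWeight : density t ≤ networkWeight t := by
  obtain ⟨𝒩, h𝒩, hle⟩ := exists_isNetwork_le_networkWeight (Y := Y)
  choose p hp using fun C : 𝒩 => h𝒩.1 C C.2
  refine aleph0_add_sInf_le (self_le_add_right _ _) ⟨range p, ?_, rfl⟩
    (Cardinal.mk_range_le.trans hle)
  refine dense_iff_inter_open.2 fun U hU ⟨y, hy⟩ => ?_
  obtain ⟨C, hC, -, hCU⟩ := h𝒩.2 y U hU hy
  exact ⟨p ⟨C, hC⟩, hCU (hp ⟨C, hC⟩), mem_range_self _⟩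

theorem lindelofDegree_le_networkWeight : lindelofDegree t ≤ networkWeight t := by
  obtain ⟨𝒩, h𝒩, hle⟩ := exists_isNetwork_le_networkWeight (Y := Y)
  refine aleph0_add_sInf_le (self_le_add_right _ _) (fun 𝒰 h𝒰 hcov => ?_) le_rfl
  choose p hp hpsub using fun C : {C : 𝒩 // ∃ U ∈ 𝒰, (C : Set Y) ⊆ U} => C.2
  refine ⟨range p, range_subset_iff.2 hp, sUnion_eq_univ_iff.2 fun y => ?_,
    Cardinal.mk_range_le.trans ((Cardinal.mk_subtype_le _).trans hle)⟩
  obtain ⟨U, hU, hyU⟩ := sUnion_eq_univ_iff.1 hcov y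
  obtain ⟨C, hC, hyC, hCU⟩ := h𝒩.2 y U (h𝒰 U hU) hyU
  exact ⟨_, mem_range_self ⟨⟨C, hC⟩, U, hU, hCU⟩, hpsub _ hyC⟩

theorem cellularity_le_density : cellularity t ≤ density t := by
  obtain ⟨_, ⟨D, hD, rfl⟩, hle⟩ := exists_mem_le_aleph0_add_sInf
    (S := {κ | ∃ D : Set Y, Dense D ∧ #D = κ}) ⟨_, univ, dense_univ, rfl⟩
  change _ ≤ density t at hle
  have h0 : ℵ₀ ≤ density t := self_le_add_right _ _
  refine Cardinal.add_le_of_le h0 h0 (csSup_le' ?_)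
  rintro _ ⟨𝒰, h𝒰, hdisj, rfl⟩
  choose p hpU hpD using fun U : ↥(𝒰 \ {∅}) =>
    hD.inter_open_nonempty U (h𝒰 U U.2.1) (nonempty_iff_ne_empty.2 U.2.2)
  have hinj : Function.Injective fun U => (⟨p U, hpD U⟩ : D) := fun U V h => by
    have h' : p U = p V := congrArg Subtype.val h
    exact Subtype.ext (hdisj.elim_set U.2.1 V.2.1 (p U) (hpU U) (h' ▸ hpU V))
  -- The empty set may belong to a disjoint family and contains no point of `D`; it costs one extra
  -- element.
  calc #𝒰 ≤ #(insert ∅ (𝒰 \ {∅}) : Set (Set Y)) := Cardinal.mk_le_mk_of_subset (by simp)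
    _ ≤ #(𝒰 \ {∅} : Set (Set Y)) + 1 := Cardinal.mk_insert_le
    _ ≤ density t := Cardinal.add_le_of_le h0 ((Cardinal.mk_le_of_injective hinj).trans hle)
      (Cardinal.one_le_aleph0.trans h0)

end Spaces

section Groups

variable {Y : Type u} [AddCommGroup Y] [t : TopologicalSpace Y]

theorem isNarrow_narrownessIndex : IsNarrow t (narrownessIndex t) := by
  obtain ⟨κ, ⟨-, h⟩, hle⟩ := exists_mem_le_aleph0_add_sInf
    (S := {κ | ℵ₀ ≤ κ ∧ IsNarrow t κ}) ⟨ℵ₀ + #Y, self_le_add_right _ _, fun U hU =>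
      ⟨univ, Cardinal.mk_univ.trans_le (self_le_add_left _ _),
        eq_univ_of_forall fun y => ⟨0, mem_of_mem_nhds hU, y, mem_univ y, zero_add y⟩⟩⟩
  intro U hU
  obtain ⟨S, hS, hUS⟩ := h U hU
  exact ⟨S, hS.trans hle, hUS⟩

variable [IsTopologicalAddGroup Y]

/-- The translates of the interior of `U` cover the group; the centres of a small subcover form the
required `S`. -/
theorem narrownessIndex_le_lindelofDegree : narrownessIndex t ≤ lindelofDegree t := by
  obtain ⟨κ, h, hle⟩ := exists_mem_le_aleph0_add_sInf
    (S := {κ | ∀ 𝒰 : Set (Set Y), (∀ U ∈ 𝒰, IsOpen U) → ⋃₀ 𝒰 = univ →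
      ∃ 𝒱 ⊆ 𝒰, ⋃₀ 𝒱 = univ ∧ #𝒱 ≤ κ})
    ⟨#(Set Y), fun 𝒰 _ h => ⟨𝒰, Subset.rfl, h, Cardinal.mk_set_le _⟩⟩
  refine aleph0_add_sInf_le (self_le_add_right _ _)
    ⟨self_le_add_right _ _, fun U hU => ?_⟩ le_rfl
  obtain ⟨𝒱, h𝒱, hcov, hcard⟩ := h (range fun s => (fun z => z - s) ⁻¹' interior U)
    (forall_mem_range.2 fun s => isOpen_interior.preimage (continuous_id.sub continuous_const))
    (sUnion_eq_univ_iff.2 fun y => ⟨_, mem_range_self y, by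
      simpa using mem_interior_iff_mem_nhds.2 hU⟩)
  choose p hp using fun V : 𝒱 => h𝒱 V.2
  refine ⟨range p, Cardinal.mk_range_le.trans (hcard.trans hle), eq_univ_of_forall fun y => ?_⟩
  obtain ⟨V, hV, hyV⟩ := sUnion_eq_univ_iff.1 hcov y
  have hy : y ∈ (fun z => z - p ⟨V, hV⟩) ⁻¹' interior U := by
    have := hp ⟨V, hV⟩
    simp only at this
    rwa [this]
  exact ⟨_, interior_subset hy, _, mem_range_self _, sub_add_cancel _ _⟩

/-- Take `V` open around `0` with `V - V ⊆ U` and a maximal `S` with the translates `V + s`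
disjoint. By maximality each `V + y` meets some `V + s`, whence `y - s ∈ V - V ⊆ U`. -/
theorem narrownessIndex_le_cellularity : narrownessIndex t ≤ cellularity t := by
  refine aleph0_add_sInf_le (self_le_add_right _ _)
    ⟨self_le_add_right _ _, fun U hU => ?_⟩ le_rfl
  obtain ⟨V, hV, h0V, hVU⟩ : ∃ V : Set Y, IsOpen V ∧ 0 ∈ V ∧ ∀ a ∈ V, ∀ b ∈ V, a - b ∈ U := by
    have hc : Tendsto (fun p : Y × Y => p.1 - p.2) (nhds (0, 0)) (nhds 0) :=
      (continuous_fst.sub continuous_snd).tendsto' _ _ (sub_zero 0)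
    obtain ⟨A, B, hA, h0A, hB, h0B, h⟩ := mem_nhds_prod_iff'.1 (hc hU)
    exact ⟨A ∩ B, hA.inter hB, ⟨h0A, h0B⟩, fun a ha b hb => h (mk_mem_prod ha.1 hb.2)⟩
  let f : Y → Set Y := fun s => (fun z => z - s) ⁻¹' V
  have hf0 : ∀ s, s ∈ f s := fun s => by simpa [f] using h0V
  obtain ⟨S, hS⟩ := zorn_subset {S : Set Y | S.PairwiseDisjoint f} fun c hc hchain =>
    ⟨⋃₀ c, (pairwiseDisjoint_sUnion hchain.directedOn).2 fun s hs => hc hs,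
      fun s hs => subset_sUnion_of_mem hs⟩
  have hSd : S.PairwiseDisjoint f := hS.prop
  refine ⟨S, ?_, eq_univ_of_forall fun y => ?_⟩
  · have hinj : InjOn f S := fun a ha b hb hab =>
      hSd.elim_set ha hb a (hf0 a) (hab ▸ hf0 a)
    rw [← Cardinal.mk_image_eq_of_injOn f S hinj]
    have hmem : #(f '' S) ∈ {κ | ∃ 𝒰 : Set (Set Y), (∀ U ∈ 𝒰, IsOpen U) ∧
        𝒰.PairwiseDisjoint id ∧ #𝒰 = κ} := by
      refine ⟨f '' S, ?_, ?_, rfl⟩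
      · rintro _ ⟨s, -, rfl⟩
        exact hV.preimage (continuous_id.sub continuous_const)
      · rintro _ ⟨a, ha, rfl⟩ _ ⟨b, hb, rfl⟩ hab
        exact hSd ha hb fun h => hab (h ▸ rfl)
    -- The supremum of an unbounded set of cardinals would be the default `0`, hence the explicit
    -- bound.
    refine (le_csSup ?_ hmem).trans (self_le_add_left _ _)
    refine ⟨#(Set Y), ?_⟩
    rintro _ ⟨𝒰, -, -, rfl⟩
    exact Cardinal.mk_set_le _
  · obtain ⟨s, hs, z, hzs, hzy⟩ : ∃ s ∈ S, ∃ z, z ∈ f s ∧ z ∈ f y := by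
      by_contra! hcon
      have hins : (insert y S).PairwiseDisjoint f := by
        refine (pairwiseDisjoint_insert).2 ⟨hSd, fun s hs _ => ?_⟩
        exact disjoint_right.2 fun z hz => hcon s hs z hz
      exact hcon y (hS.2 hins (subset_insert _ _) (mem_insert _ _)) y (hf0 y) (hf0 y)
    -- Here `y - s = (z - s) - (z - y)`.
    exact ⟨y - s, by simpa using hVU _ hzs _ hzy, s, hs, sub_add_cancel _ _⟩

/-- The weight of a `κ`-narrow topological group of character at most `κ` is at most `κ`. -/
theorem weight_le_of_isNarrow {ι : Type u} {κ : Cardinal.{u}} (hκ : ℵ₀ ≤ κ) (hι : #ι ≤ κ)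
    (N : ι → Set Y) (hN : ∀ i, N i ∈ nhds (0 : Y)) (hbase : ∀ U ∈ nhds (0 : Y), ∃ i, N i ⊆ U)
    (hnar : IsNarrow t κ) : weight t ≤ κ := by
  choose S hS hcov using fun i => hnar _ (interior_mem_nhds.2 (hN i))
  refine aleph0_add_sInf_le hκ
    ⟨range fun p : Σ i, S i => (fun z => z - (p.2 : Y)) ⁻¹' interior (N p.1), ?_, rfl⟩ ?_
  · refine TopologicalSpace.isTopologicalBasis_of_isOpen_of_nhds
      (forall_mem_range.2 fun p => isOpen_interior.preimage (continuous_id.sub continuous_const))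
      fun y O hy hO => ?_
    have hc : Tendsto (fun p : Y × Y => p.1 - p.2 + y) (nhds (0, 0)) (nhds y) :=
      ((continuous_fst.sub continuous_snd).add continuous_const).tendsto' _ _ (by simp)
    -- These satisfy `A - B + y ⊆ O`. With `N i ⊆ A ∩ B` and `y = u + s`, the translate of the
    -- interior of `N i` by `s` contains `y` and lies in `O`.
    obtain ⟨A, hA, B, hB, hAB⟩ := mem_nhds_prod_iff.1 (hc (hO.mem_nhds hy))
    obtain ⟨i, hi⟩ := hbase _ (inter_mem hA hB)
    obtain ⟨u, hu, s, hs, rfl⟩ : y ∈ interior (N i) + S i := hcov i ▸ mem_univ y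
    refine ⟨_, mem_range_self ⟨i, s, hs⟩, by simpa using hu, fun z hz => ?_⟩
    have hmem : z - s - u + (u + s) ∈ O :=
      hAB (mk_mem_prod (hi (interior_subset hz)).1 (hi (interior_subset hu)).2)
    rwa [show z - s - u + (u + s) = z by abel] at hmem
  · refine Cardinal.mk_range_le.trans ?_
    rw [Cardinal.mk_sigma]
    calc Cardinal.sum (fun i => #(S i)) ≤ Cardinal.sum (fun _ : ι => κ) :=
          Cardinal.sum_le_sum _ _ hS
      _ = #ι * κ := Cardinal.sum_const' _ _
      _ ≤ κ * κ := mul_le_mul_left hι κ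
      _ = κ := Cardinal.mul_eq_self hκ

end Groups

/-! ### The group `C(X)` with the topology of Whitney convergence -/

section Whitney

theorem exists_isBase_le_bornologyWeight {X : Type u} (𝓑 : Set (Set X)) :
    ∃ 𝓑₀, IsBase 𝓑 𝓑₀ ∧ #𝓑₀ ≤ bornologyWeight 𝓑 := by
  obtain ⟨_, ⟨𝓑₀, h, rfl⟩, hle⟩ := exists_mem_le_aleph0_add_sInf
    (S := {κ | ∃ 𝓑₀, IsBase 𝓑 𝓑₀ ∧ #𝓑₀ = κ})
    ⟨_, 𝓑, ⟨Subset.rfl, fun B hB => ⟨B, hB, Subset.rfl⟩⟩, rfl⟩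
  exact ⟨𝓑₀, h, hle⟩

theorem isTopologicalAddGroup_whitneyTopologyOn {X : Type u} [TopologicalSpace X]
    (𝓑 : Set (Set X)) : @IsTopologicalAddGroup C(X, ℝ) (whitneyTopologyOn 𝓑) _ := by
  let := whitneyUniformity 𝓑
  have : IsUniformAddGroup C(X, ℝ) := by
    refine ⟨le_entourageFilter fun B hB ε hε => ?_⟩
    have hε' : (2⁻¹ : ℝ) • ε ∈ positiveFunctions X := fun x => by simpa using hε x
    have hmem : entourage B ((2⁻¹ : ℝ) • ε) ∈ uniformity C(X, ℝ) := entourage_mem hB hε'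
    rw [mem_map, uniformity_prod_eq_prod, mem_map]
    refine mem_of_superset (prod_mem_prod hmem hmem) ?_
    rintro ⟨⟨f, f'⟩, ⟨g, g'⟩⟩ ⟨h₁, h₂⟩ x hx
    have e₁ := h₁ x hx
    have e₂ := h₂ x hx
    simp only [ContinuousMap.smul_apply, smul_eq_mul] at e₁ e₂
    change |(f x - g x) - (f' x - g' x)| < ε x
    rw [abs_lt] at *
    constructor <;> linarith [e₁.1, e₁.2, e₂.1, e₂.2]
  infer_instance

variable {X : Type u} [TopologicalSpace X] {𝓑 : Set (Set X)}

theorem hasBasis_nhds_zero [Nonempty X] (h𝓑 : IsBornology 𝓑) :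
    (@nhds _ (whitneyTopologyOn 𝓑) (0 : C(X, ℝ))).HasBasis
      (fun p : Set X × C(X, ℝ) => p.1 ∈ 𝓑 ∧ p.2 ∈ positiveFunctions X)
      (fun p => {f | ∀ x ∈ p.1, |f x| < p.2 x}) := by
  let := whitneyUniformity 𝓑
  simpa [entourage, UniformSpace.ball, preimage] using
    nhds_basis_uniformity' (hasBasis_whitneyUniformity h𝓑)
      (x := (0 : C(X, ℝ)))

/-- The pairs of a base member `B` and an `s` from its narrowness set `S B` index a neighbourhood
base at `0`. -/
theorem weight_whitney_le (h𝓑 : IsBornology 𝓑) :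
    weight (whitneyTopologyOn 𝓑) ≤
      bornologyWeight 𝓑 * narrownessIndex (whitneyTopologyOn 𝓑) := by
  have hb : ℵ₀ ≤ bornologyWeight 𝓑 := self_le_add_right _ _
  have hi : ℵ₀ ≤ narrownessIndex (whitneyTopologyOn 𝓑) := self_le_add_right _ _
  have hle := Cardinal.le_mul_left (a := narrownessIndex (whitneyTopologyOn 𝓑))
    (Cardinal.aleph0_pos.trans_le hb).ne'
  have hκ := hi.trans hle
  let := whitneyTopologyOn 𝓑
  have := isTopologicalAddGroup_whitneyTopologyOn 𝓑
  have hnar : IsNarrow (whitneyTopologyOn 𝓑) (narrownessIndex (whitneyTopologyOn 𝓑)) :=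
    isNarrow_narrownessIndex
  have hnar' : IsNarrow (whitneyTopologyOn 𝓑)
      (bornologyWeight 𝓑 * narrownessIndex (whitneyTopologyOn 𝓑)) := fun U hU => by
    obtain ⟨S, hS, hUS⟩ := hnar U hU
    exact ⟨S, hS.trans hle, hUS⟩
  rcases isEmpty_or_nonempty X with hX | hX
  -- On empty `X` the group `C(X)` is a single point.
  · exact weight_le_of_isNarrow hκ (ι := PUnit) (by simpa using Cardinal.one_le_aleph0.trans hκ)
      (fun _ => univ) (fun _ => univ_mem)
      (fun U hU => ⟨⟨⟩, fun f _ => Subsingleton.elim 0 f ▸ mem_of_mem_nhds hU⟩) hnar'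
  obtain ⟨𝓑₀, h𝓑₀, hcard⟩ := exists_isBase_le_bornologyWeight 𝓑
  have hbasis := hasBasis_nhds_zero h𝓑
  choose S hS hcov using fun B : 𝓑₀ =>
    hnar _ (hbasis.mem_of_mem (i := ((B : Set X), 1)) ⟨h𝓑₀.1 B.2, fun x => by simp⟩)
  let δ : C(X, ℝ) → C(X, ℝ) := fun s =>
    ⟨fun x => (|s x| + 1)⁻¹, (s.continuous.abs.add continuous_const).inv₀ fun x =>
      (by positivity : 0 < |s x| + 1).ne'⟩
  have hδ : ∀ s, δ s ∈ positiveFunctions X := fun s x => by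
    change 0 < (|s x| + 1)⁻¹
    positivity
  refine weight_le_of_isNarrow hκ (ι := Σ B : 𝓑₀, S B) ?_
    (fun p => {f | ∀ x ∈ (p.1 : Set X), |f x| < δ p.2 x})
    (fun p => hbasis.mem_of_mem (i := ((p.1 : Set X), δ p.2)) ⟨h𝓑₀.1 p.1.2, hδ p.2⟩) ?_ hnar'
  · rw [Cardinal.mk_sigma]
    calc Cardinal.sum (fun B => #(S B))
        ≤ Cardinal.sum (fun _ : 𝓑₀ => narrownessIndex (whitneyTopologyOn 𝓑)) :=
          Cardinal.sum_le_sum _ _ hS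
      _ = #𝓑₀ * narrownessIndex (whitneyTopologyOn 𝓑) := Cardinal.sum_const' _ _
      _ ≤ _ := mul_le_mul_left hcard _
  · intro U hU
    obtain ⟨⟨B, ε⟩, ⟨hB, hε⟩, hBU⟩ := hbasis.mem_iff.1 hU
    obtain ⟨B', hB', hBB'⟩ := h𝓑₀.2 B hB
    let g : C(X, ℝ) := ⟨fun x => (ε x)⁻¹, ε.continuous.inv₀ fun x => (hε x).ne'⟩
    -- Large values of `1/ε` encode small values of `ε`, so uniform approximation of `1/ε` suffices.
    obtain ⟨u, hu, s, hs, hus⟩ : g ∈ _ + S ⟨B', hB'⟩ := hcov ⟨B', hB'⟩ ▸ mem_univ g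
    refine ⟨⟨⟨B', hB'⟩, s, hs⟩, fun f hf => hBU fun x hx => (hf x (hBB' hx)).trans ?_⟩
    have h₁ : |u x| < 1 := hu x (hBB' hx)
    have h₂ : u x + s x = (ε x)⁻¹ := DFunLike.congr_fun hus x
    change (|s x| + 1)⁻¹ < ε x
    refine inv_lt_of_inv_lt₀ (hε x) ?_
    linarith [le_abs_self (u x), le_abs_self (s x)]

/-- Each basic open set around `0` contains some `[C, ε]`-ball with `C` closed in `𝓑`; one such `C`
per basic set already gives a base of `𝓑`. -/
theorem bornologyWeight_le_weight [CompletelyRegularSpace X] (h𝓑 : IsBornology 𝓑)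
    (hcl : HasClosedBase 𝓑) : bornologyWeight 𝓑 ≤ weight (whitneyTopologyOn 𝓑) := by
  have hw : ℵ₀ ≤ weight (whitneyTopologyOn 𝓑) := self_le_add_right _ _
  rcases isEmpty_or_nonempty X with hX | hX
  · refine aleph0_add_sInf_le hw ⟨∅, ⟨empty_subset _, fun B hB => ?_⟩, rfl⟩ (by simp)
    obtain ⟨x, -⟩ := h𝓑.nonempty B hB
    exact hX.elim x
  obtain ⟨𝓒, h𝓒, hclosed⟩ := hcl
  let := whitneyTopologyOn 𝓑
  have hbasis := hasBasis_nhds_zero h𝓑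
  obtain ⟨𝒮, h𝒮, hcard⟩ := exists_isTopologicalBasis_le_weight (Y := C(X, ℝ))
  have key : ∀ W : {W : 𝒮 // (0 : C(X, ℝ)) ∈ (W : Set C(X, ℝ))}, ∃ C ∈ 𝓒,
      ∃ ε ∈ positiveFunctions X, {f : C(X, ℝ) | ∀ x ∈ C, |f x| < ε x} ⊆ W := by
    intro W
    obtain ⟨⟨B, ε⟩, ⟨hB, hε⟩, h⟩ := hbasis.mem_iff.1 (h𝒮.mem_nhds W.1.2 W.2)
    obtain ⟨C, hC, hBC⟩ := h𝓒.2 B hB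
    exact ⟨C, hC, ε, hε, fun f hf => h fun x hx => hf x (hBC hx)⟩
  choose C hC ε hε hsub using key
  refine aleph0_add_sInf_le hw
    ⟨range C, ⟨range_subset_iff.2 fun W => h𝓒.1 (hC W), fun B hB => ?_⟩, rfl⟩
    (Cardinal.mk_range_le.trans ((Cardinal.mk_subtype_le _).trans hcard))
  obtain ⟨W, hW, h0W, hWB⟩ := h𝒮.mem_nhds_iff.1
    (hbasis.mem_of_mem (i := (B, 1)) ⟨hB, fun x => by simp⟩)
  refine ⟨_, mem_range_self ⟨⟨W, hW⟩, h0W⟩, fun x hx => ?_⟩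
  by_contra hxC
  obtain ⟨g, hg, hgx, hgC⟩ := CompletelyRegularSpace.completely_regular x _ (hclosed _ (hC _)) hxC
  -- If `x ∈ B` were outside `C`, this `f`, zero on `C` and `1` at `x`, would lie in `W` but not in
  -- the ball `[B, 1]`.
  let f : C(X, ℝ) := ⟨fun y => 1 - (g y : ℝ), continuous_const.sub (continuous_subtype_val.comp hg)⟩
  have hf : f ∈ W := hsub ⟨⟨W, hW⟩, h0W⟩ fun y hy => by
    have : f y = 0 := by simp [f, hgC hy]
    rw [this, abs_zero]
    exact hε _ y
  have h₁ : |f x| < 1 := hWB hf x hx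
  simp [f, hgx] at h₁

theorem hasClosedBase_nonemptySets : HasClosedBase (nonemptySets X) :=
  ⟨{A | A.Nonempty ∧ IsClosed A}, ⟨fun _ h => h.1, fun B hB =>
    ⟨closure B, ⟨hB.closure, isClosed_closure⟩, subset_closure⟩⟩, fun _ h => h.2⟩

end Whitney

theorem bornologyWeight_nonemptySets (X : Type u) : bornologyWeight (nonemptySets X) = ℵ₀ := by
  -- The whole space alone is a base; the nonemptiness condition discards it when `X` is empty.
  refine le_antisymm (aleph0_add_sInf_le le_rfl ⟨{A | A.Nonempty ∧ A = univ}, ⟨fun _ h => h.1,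
    fun B hB => ⟨univ, ⟨hB.mono (subset_univ B), rfl⟩, subset_univ B⟩⟩, rfl⟩ ?_)
    (self_le_add_right _ _)
  exact (Cardinal.mk_le_mk_of_subset (t := {univ}) fun _ h => h.2).trans
    ((Cardinal.mk_singleton _).trans_le Cardinal.one_le_aleph0)

end WhitneyBornology

open WhitneyBornology in
theorem mainTheorem7 {X : Type u} [MetricSpace X] :
    (∀ 𝓑 : Set (Set X), IsBornology 𝓑 → HasClosedBase 𝓑 →
      weight (whitneyTopologyOn 𝓑) =
          bornologyWeight 𝓑 * narrownessIndex (whitneyTopologyOn 𝓑) ∧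
      weight (whitneyTopologyOn 𝓑) =
          bornologyWeight 𝓑 * cellularity (whitneyTopologyOn 𝓑) ∧
      weight (whitneyTopologyOn 𝓑) =
          bornologyWeight 𝓑 * lindelofDegree (whitneyTopologyOn 𝓑) ∧
      weight (whitneyTopologyOn 𝓑) =
          bornologyWeight 𝓑 * density (whitneyTopologyOn 𝓑) ∧
      weight (whitneyTopologyOn 𝓑) =
          bornologyWeight 𝓑 * networkWeight (whitneyTopologyOn 𝓑)) ∧
    (weight (whitneyTopology X) = narrownessIndex (whitneyTopology X) ∧
      weight (whitneyTopology X) = cellularity (whitneyTopology X) ∧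
      weight (whitneyTopology X) = lindelofDegree (whitneyTopology X) ∧
      weight (whitneyTopology X) = density (whitneyTopology X) ∧
      weight (whitneyTopology X) = networkWeight (whitneyTopology X)) := by
  have main : ∀ 𝓑 : Set (Set X), IsBornology 𝓑 → HasClosedBase 𝓑 →
      weight (whitneyTopologyOn 𝓑) =
          bornologyWeight 𝓑 * narrownessIndex (whitneyTopologyOn 𝓑) ∧
      weight (whitneyTopologyOn 𝓑) =
          bornologyWeight 𝓑 * cellularity (whitneyTopologyOn 𝓑) ∧
      weight (whitneyTopologyOn 𝓑) =
          bornologyWeight 𝓑 * lindelofDegree (whitneyTopologyOn 𝓑) ∧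
      weight (whitneyTopologyOn 𝓑) =
          bornologyWeight 𝓑 * density (whitneyTopologyOn 𝓑) ∧
      weight (whitneyTopologyOn 𝓑) =
          bornologyWeight 𝓑 * networkWeight (whitneyTopologyOn 𝓑) := by
    intro 𝓑 h𝓑 hcl
    have hle := weight_whitney_le h𝓑
    have hb := bornologyWeight_le_weight h𝓑 hcl
    have hw : ℵ₀ ≤ weight (whitneyTopologyOn 𝓑) := self_le_add_right _ _
    let := whitneyTopologyOn 𝓑
    have := isTopologicalAddGroup_whitneyTopologyOn 𝓑
    have hic : narrownessIndex (whitneyTopologyOn 𝓑) ≤ cellularity (whitneyTopologyOn 𝓑) :=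
      narrownessIndex_le_cellularity
    have hiL : narrownessIndex (whitneyTopologyOn 𝓑) ≤ lindelofDegree (whitneyTopologyOn 𝓑) :=
      narrownessIndex_le_lindelofDegree
    have hcd : cellularity (whitneyTopologyOn 𝓑) ≤ density (whitneyTopologyOn 𝓑) :=
      cellularity_le_density
    have hdn : density (whitneyTopologyOn 𝓑) ≤ networkWeight (whitneyTopologyOn 𝓑) :=
      density_le_networkWeight
    have hLn : lindelofDegree (whitneyTopologyOn 𝓑) ≤ networkWeight (whitneyTopologyOn 𝓑) :=
      lindelofDegree_le_networkWeight
    have hnw : networkWeight (whitneyTopologyOn 𝓑) ≤ weight (whitneyTopologyOn 𝓑) :=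
      networkWeight_le_weight
    have hdw := hdn.trans hnw
    have hid := hic.trans hcd
    exact ⟨eq_mul_of_le hw hb hle le_rfl (hid.trans hdw),
      eq_mul_of_le hw hb hle hic (hcd.trans hdw),
      eq_mul_of_le hw hb hle hiL (hLn.trans hnw),
      eq_mul_of_le hw hb hle hid hdw,
      eq_mul_of_le hw hb hle (hid.trans hdn) hnw⟩
  refine ⟨main, ?_⟩
  have h := main _ isBornology_nonemptySets hasClosedBase_nonemptySets
  rw [bornologyWeight_nonemptySets] at h
  have hmul : ∀ φ : Cardinal.{u}, ℵ₀ * (ℵ₀ + φ) = ℵ₀ + φ := fun φ =>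
    Cardinal.aleph0_mul_eq (self_le_add_right _ _)
  simpa only [narrownessIndex, cellularity, lindelofDegree, density, networkWeight, hmul] using h
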